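/- **Theorem 6.9 (faces of the pinwheel tiling).** The pinwheel substitution inflates a right triangle with legs $1$ and $2$ by the factor $\sqrt5$ and dissects the result into five right triangles with legs $1$ and $2$ as follows: if the inflated triangle has its right angle at $R$, short leg $RS$ and long leg $RL$, let $D=S+\tfrac15(L-S)$, $E=S+\tfrac35(L-S)$, let $M$ be the midpoint of $RL$ and $N$ the midpoint of $RD$; the five tiles are the triangles $DSR$, $NRM$, $NDM$, $EMD$, $EML$. The patch obtained from one triangle by $n$ substitutions is called a supertile of level $n$. A pinwheel tiling is a tiling of the plane by such triangles, each finite patch of which is congruent to a part of a supertile. A proper face colouring gives different colours to any two distinct tiles that share a nondegenerate segment of their boundaries. The minimum number of colours needed for a proper face colouring of any pinwheel tiling is exactly $3$. -/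

import Mathlib

namespace Pinwheel

/-- A triangle in the Euclidean plane `ℂ` with labelled vertices: `R` is the vertex at the right
angle, `S` the other end of the short leg, `L` the other end of the long leg. (All triangles used
below are similar to the one with legs `1` and `2`, where the labels are determined by the
shape.) -/
@[ext]
structure Triangle where
  R : ℂ
  S : ℂ
  L : ℂ

namespace Triangle

/-- The closed triangular region. -/
def carrier (t : Triangle) : Set ℂ := convexHull ℝ {t.R, t.S, t.L}

/-- The image under a map of the plane, taken on vertices. -/
def map (f : ℂ → ℂ) (t : Triangle) : Triangle := ⟨f t.R, f t.S, f t.L⟩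

/-- The point of the hypotenuse at one fifth of the way from `S` to `L`
(the foot of the altitude from `R`). -/
noncomputable def ptD (t : Triangle) : ℂ := AffineMap.lineMap t.S t.L (1 / 5 : ℝ)

/-- The point of the hypotenuse at three fifths of the way from `S` to `L`. -/
noncomputable def ptE (t : Triangle) : ℂ := AffineMap.lineMap t.S t.L (3 / 5 : ℝ)

/-- The midpoint of the long leg. -/
noncomputable def ptM (t : Triangle) : ℂ := midpoint ℝ t.R t.L

/-- The midpoint of the altitude from `R`. -/
noncomputable def ptN (t : Triangle) : ℂ := midpoint ℝ t.R t.ptD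

/-- The pinwheel dissection of a triangle into five triangles, smaller by the factor `√5`. -/
noncomputable def dissect (t : Triangle) : Set Triangle :=
  {⟨t.ptD, t.S, t.R⟩, ⟨t.ptN, t.R, t.ptM⟩, ⟨t.ptN, t.ptD, t.ptM⟩,
    ⟨t.ptE, t.ptM, t.ptD⟩, ⟨t.ptE, t.ptM, t.L⟩}

/-- The pinwheel substitution: inflate a tile by `√5` and dissect it. -/
noncomputable def substitute (t : Triangle) : Set Triangle :=
  (t.map fun z => Real.sqrt 5 • z).dissect

end Triangle

/-- The prototile, a right triangle with legs `1` and `2`. -/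
def prototile : Triangle := ⟨0, 1, 2 * Complex.I⟩

/-- The supertile of level `n`: the patch obtained from the prototile by `n` substitutions. -/
noncomputable def supertile : ℕ → Set Triangle
  | 0 => {prototile}
  | n + 1 => ⋃ t ∈ supertile n, t.substitute

/-- A pinwheel tiling: a set of tiles that cover the plane without overlaps, such that each finite
patch is congruent to a part of a supertile. -/
structure IsPinwheelTiling (T : Set Triangle) : Prop where
  covers : ⋃ t ∈ T, t.carrier = Set.univ
  nonoverlapping : ∀ s ∈ T, ∀ t ∈ T, s ≠ t → Disjoint (interior s.carrier) (interior t.carrier)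
  legal : ∀ P : Set Triangle, P ⊆ T → P.Finite →
    ∃ (n : ℕ) (f : ℂ ≃ᵢ ℂ), P ⊆ Triangle.map f '' supertile n

/-- The adjacency graph of the faces: two distinct tiles are adjacent if they share
a nondegenerate segment (not merely a vertex). -/
def faceGraph (T : Set Triangle) : SimpleGraph T where
  Adj s t := s ≠ t ∧ ∃ x y : ℂ, x ≠ y ∧ segment ℝ x y ⊆ s.1.carrier ∩ t.1.carrier
  symm := ⟨fun _ _ h => ⟨h.1.symm, by simpa only [Set.inter_comm] using h.2⟩⟩
  loopless := ⟨fun _ h => h.1 rfl⟩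

end Pinwheel

/-!
An affine functional is read off the barycentric coordinates, so the way in which two parts of an
iterated dissection lie relative to each other is recorded by the rational `3 × 3` matrix of the
barycentric coordinates of the one with respect to the other. By induction on the level, two parts
of the same level either have at most one common point or are in one of twelve relative positions.

Every part is given a label in `ZMod 3 × ZMod 2`, computed from the label of the part that contains
it; the possible differences of the labels of two parts in a given relative position are preserved
by dissection, and their first components are nonzero for distinct parts. So the first component
of the label is a proper colouring of each supertile, and a compactness argument (the
de Bruijn–Erdős theorem) gives a proper 3-colouring of the whole tiling.

Conversely, every tile of the tiling is a part of a dissected triangle all of whose parts are tiles,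
and the three parts which meet at the midpoint of the altitude are mutually adjacent.
-/

namespace Pinwheel

open Matrix

section Convex

variable {E : Type*} {s t : Set E}

theorem convex_insert_preimage_Iio [AddCommGroup E] [Module ℝ E] (φ : E →ᵃ[ℝ] ℝ) {c : ℝ} {v : E}
    (hv : φ v ≤ c) : Convex ℝ (insert v (φ ⁻¹' Set.Iio c)) := by
  refine convex_iff_forall_pos.2 fun x hx y hy a b ha hb hab => ?_
  have hφ : φ (a • x + b • y) = a * φ x + b * φ y := Convex.combo_affine_apply hab
  obtain rfl : b = 1 - a := by linarith
  simp only [Set.mem_insert_iff, Set.mem_preimage, Set.mem_Iio, hφ] at hx hy ⊢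
  rcases hx with rfl | hx <;> rcases hy with rfl | hy
  · exact Or.inl (Convex.combo_self hab _)
  all_goals exact Or.inr (by nlinarith)

theorem subsingleton_convexHull_inter [AddCommGroup E] [Module ℝ E] (φ : E →ᵃ[ℝ] ℝ) {c : ℝ} {v : E}
    (hv : φ v ≤ c) (hs : ∀ x ∈ s, x ≠ v → φ x < c) (ht : ∀ x ∈ t, c ≤ φ x) :
    (convexHull ℝ s ∩ convexHull ℝ t).Subsingleton := by
  have hs' : convexHull ℝ s ⊆ insert v (φ ⁻¹' Set.Iio c) :=
    convexHull_min (fun x hx => or_iff_not_imp_left.2 (hs x hx)) (convex_insert_preimage_Iio φ hv)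
  have ht' : convexHull ℝ t ⊆ φ ⁻¹' Set.Ici c :=
    convexHull_min ht ((convex_Ici c).affine_preimage φ)
  exact Set.subsingleton_of_subset_singleton fun x hx =>
    (hs' hx.1).resolve_right fun h : φ x < c => h.not_ge (ht' hx.2)

theorem disjoint_interior_of_subsingleton_inter [NormedAddCommGroup E] [NormedSpace ℝ E]
    [Nontrivial E] (ht : Convex ℝ t) (ht' : (interior t).Nonempty) (h : (s ∩ t).Subsingleton) :
    Disjoint (interior s) t := by
  refine Set.disjoint_left.2 fun x hxs hxt => ?_
  have hx : x ∈ closure (interior t) := by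
    rw [ht.closure_interior_eq_closure_of_nonempty_interior ht']
    exact subset_closure hxt
  obtain ⟨y, hys, hyt⟩ := mem_closure_iff.1 hx _ isOpen_interior hxs
  have hy : y ∈ interior (s ∩ t) := by rw [interior_inter]; exact ⟨hys, hyt⟩
  rcases h.eq_empty_or_singleton with h | ⟨z, h⟩ <;> simp [h] at hy

end Convex

theorem sum_ratCast_row {m n : Type*} [Fintype n] {A : Matrix m n ℚ} (hA : A *ᵥ 1 = 1) (r : m) :
    ∑ k, (A r k : ℝ) = 1 := by
  have h : ∑ k, A r k = 1 := by rw [← dotProduct_one]; exact congrFun hA r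
  exact_mod_cast h

namespace Triangle

/-- The vertices of a triangle as an indexed family, in the order `R`, `S`, `L`. -/
def vertex (t : Triangle) : Fin 3 → ℂ := ![t.R, t.S, t.L]

theorem vertex_injective : Function.Injective vertex := fun _ _ h =>
  Triangle.ext (congrFun h 0) (congrFun h 1) (congrFun h 2)

theorem carrier_eq_convexHull_range (t : Triangle) :
    t.carrier = convexHull ℝ (Set.range t.vertex) := by
  rw [carrier, vertex, Matrix.range_cons, Matrix.range_cons_cons_empty]; rfl

theorem isCompact_carrier (t : Triangle) : IsCompact t.carrier :=
  (Set.toFinite _).isCompact_convexHull ℝ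

theorem vertex_mem_carrier (t : Triangle) (r : Fin 3) : t.vertex r ∈ t.carrier := by
  rw [carrier_eq_convexHull_range]
  exact subset_convexHull ℝ _ (Set.mem_range_self r)

theorem vertex_map (f : ℂ → ℂ) (t : Triangle) : (t.map f).vertex = f ∘ t.vertex := by
  funext r
  fin_cases r <;> rfl

/-- The triangle `A • t` is the one whose vertices have the rows of `A` as barycentric coordinates
with respect to `t`; this is its meaning when the rows of `A` have sum `1`. -/
noncomputable instance : SMul (Matrix (Fin 3) (Fin 3) ℚ) Triangle where
  smul A t :=
    ⟨A 0 0 • t.R + A 0 1 • t.S + A 0 2 • t.L, A 1 0 • t.R + A 1 1 • t.S + A 1 2 • t.L,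
      A 2 0 • t.R + A 2 1 • t.S + A 2 2 • t.L⟩

theorem smul_def (A : Matrix (Fin 3) (Fin 3) ℚ) (t : Triangle) :
    A • t = ⟨A 0 0 • t.R + A 0 1 • t.S + A 0 2 • t.L, A 1 0 • t.R + A 1 1 • t.S + A 1 2 • t.L,
      A 2 0 • t.R + A 2 1 • t.S + A 2 2 • t.L⟩ :=
  rfl

theorem vertex_smul (A : Matrix (Fin 3) (Fin 3) ℚ) (t : Triangle) (r : Fin 3) :
    (A • t).vertex r = ∑ k, A r k • t.vertex k := by
  rw [Fin.sum_univ_three]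
  fin_cases r <;> rfl

noncomputable instance : MulAction (Matrix (Fin 3) (Fin 3) ℚ) Triangle where
  one_smul t := vertex_injective <| funext fun r => by
    simp [vertex_smul, Matrix.one_apply]
  mul_smul A B t := vertex_injective <| funext fun r => by
    simp only [vertex_smul, Matrix.mul_apply, Finset.sum_smul, Finset.smul_sum, mul_smul]
    exact Finset.sum_comm

variable {A B : Matrix (Fin 3) (Fin 3) ℚ}

theorem vertex_smul_eq_affineCombination (hA : A *ᵥ 1 = 1) (t : Triangle) (r : Fin 3) :
    (A • t).vertex r = Finset.univ.affineCombination ℝ t.vertex fun k => (A r k : ℝ) := by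
  rw [Finset.affineCombination_eq_linear_combination _ _ _ (sum_ratCast_row hA r), vertex_smul]
  simp only [Rat.cast_smul_eq_qsmul]

theorem carrier_smul_subset (hA : A *ᵥ 1 = 1) (hA₀ : ∀ r k, 0 ≤ A r k) (t : Triangle) :
    (A • t).carrier ⊆ t.carrier := by
  rw [carrier_eq_convexHull_range, carrier_eq_convexHull_range]
  refine convexHull_min (Set.range_subset_iff.2 fun r => ?_) (convex_convexHull ..)
  rw [vertex_smul_eq_affineCombination hA]
  exact affineCombination_mem_convexHull (fun k _ => by exact_mod_cast hA₀ r k)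
    (sum_ratCast_row hA r)

theorem map_smul (f : ℂ →ᵃ[ℝ] ℂ) (hA : A *ᵥ 1 = 1) (t : Triangle) :
    (A • t).map f = A • t.map f := by
  refine vertex_injective <| funext fun r => ?_
  rw [vertex_map, Function.comp_apply, vertex_smul_eq_affineCombination hA,
    vertex_smul_eq_affineCombination hA, vertex_map,
    Finset.map_affineCombination _ _ _ (sum_ratCast_row hA r)]

/-- A triangle of arbitrary shape whose vertices are not collinear. -/
def Nondegenerate (t : Triangle) : Prop := AffineIndependent ℝ t.vertex

theorem nondegenerate_prototile : prototile.Nondegenerate := by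
  refine (affineIndependent_iff_of_fintype ℝ _).2 fun w hw hw' => ?_
  rw [Finset.weightedVSub_eq_linear_combination _ hw] at hw'
  obtain ⟨h₁, h₂⟩ : w 1 = 0 ∧ w 2 = 0 := by
    simpa [Fin.sum_univ_three, prototile, vertex, Complex.ext_iff] using hw'
  rw [Fin.sum_univ_three] at hw
  exact Fin.forall_fin_succ.2 ⟨by linarith, Fin.forall_fin_two.2 ⟨h₁, h₂⟩⟩

/-- The rows of `A` are the barycentric coordinates, with respect to a triangle, of the vertices of
a second one that has at most one point in common with it, by the values of the `k`-th coordinate: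
the second triangle lies beyond the parallel through the vertex `k` to the opposite side, or it lies
beyond that side with at most one vertex on it. -/
def Separates (k : Fin 3) (A : Matrix (Fin 3) (Fin 3) ℚ) : Prop :=
  (∀ r, 1 ≤ A r k) ∨ ∃ v, A v k ≤ 0 ∧ ∀ r ≠ v, A r k < 0

instance (k : Fin 3) (A : Matrix (Fin 3) (Fin 3) ℚ) : Decidable (Separates k A) :=
  inferInstanceAs (Decidable (_ ∨ _))

namespace Nondegenerate

variable {t : Triangle}

theorem vertex_injective (ht : t.Nondegenerate) : Function.Injective t.vertex :=
  AffineIndependent.injective ht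

theorem map (ht : t.Nondegenerate) {f : ℂ →ᵃ[ℝ] ℂ} (hf : Function.Injective f) :
    (t.map f).Nondegenerate := by
  rw [Nondegenerate, vertex_map]
  exact AffineIndependent.map' ht f hf

theorem affineSpan_eq_top (ht : t.Nondegenerate) : affineSpan ℝ (Set.range t.vertex) = ⊤ :=
  (AffineIndependent.affineSpan_eq_top_iff_card_eq_finrank_add_one ht).2 (by simp)

theorem smul (ht : t.Nondegenerate) (hA : A *ᵥ 1 = 1) (hBA : B * A = 1) :
    (A • t).Nondegenerate := by
  have hB : B *ᵥ 1 = 1 := by rw [← hA, mulVec_mulVec, hBA, one_mulVec, hA]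
  have hspan : affineSpan ℝ (Set.range (A • t).vertex) = ⊤ := by
    rw [eq_top_iff, ← ht.affineSpan_eq_top, affineSpan_le]
    refine Set.range_subset_iff.2 fun r => ?_
    have hr : t.vertex r = (B • A • t).vertex r := by rw [← mul_smul, hBA, one_smul]
    rw [hr, vertex_smul_eq_affineCombination hB]
    exact affineCombination_mem_affineSpan (sum_ratCast_row hB r) _
  refine (affineIndependent_iff_finrank_vectorSpan_eq ℝ _ (n := 2) (by simp)).2 ?_
  rw [AffineSubspace.vectorSpan_eq_top_of_affineSpan_eq_top _ _ _ hspan]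
  simp

/-- The vertices of a nondegenerate triangle as an affine basis of the plane, used for its
barycentric coordinates. -/
noncomputable def basis (ht : t.Nondegenerate) : AffineBasis (Fin 3) ℝ ℂ :=
  ⟨t.vertex, ht, ht.affineSpan_eq_top⟩

theorem coord_vertex (ht : t.Nondegenerate) (k r : Fin 3) :
    ht.basis.coord k (t.vertex r) = if k = r then 1 else 0 :=
  ht.basis.coord_apply k r

theorem coord_vertex_smul (ht : t.Nondegenerate) (hA : A *ᵥ 1 = 1) (k r : Fin 3) :
    ht.basis.coord k ((A • t).vertex r) = A r k := by
  rw [vertex_smul_eq_affineCombination hA]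
  exact ht.basis.coord_apply_combination_of_mem (Finset.mem_univ k) (sum_ratCast_row hA r)

theorem interior_carrier (ht : t.Nondegenerate) :
    interior t.carrier = {x | ∀ k, 0 < ht.basis.coord k x} := by
  rw [carrier_eq_convexHull_range]
  exact ht.basis.interior_convexHull

theorem interior_carrier_nonempty (ht : t.Nondegenerate) : (interior t.carrier).Nonempty := by
  rw [carrier_eq_convexHull_range]
  exact interior_convexHull_nonempty_iff_affineSpan_eq_top.2 ht.affineSpan_eq_top

theorem disjoint_interior_carrier_smul (ht : t.Nondegenerate) (hA : A *ᵥ 1 = 1) {k : Fin 3}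
    (hk : ∀ r, A r k ≤ 0) : Disjoint (interior t.carrier) (A • t).carrier := by
  have h : (A • t).carrier ⊆ ht.basis.coord k ⁻¹' Set.Iic 0 := by
    rw [carrier_eq_convexHull_range]
    refine convexHull_min (Set.range_subset_iff.2 fun r => ?_) ((convex_Iic 0).affine_preimage _)
    rw [Set.mem_preimage, ht.coord_vertex_smul hA]
    exact Set.mem_Iic.2 (by exact_mod_cast hk r)
  rw [ht.interior_carrier]
  exact Set.disjoint_left.2 fun x hx hx' => (hx k).not_ge (h hx')

theorem subsingleton_carrier_inter_smul (ht : t.Nondegenerate) (hA : A *ᵥ 1 = 1) {k : Fin 3}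
    (h : Separates k A) : (t.carrier ∩ (A • t).carrier).Subsingleton := by
  rw [carrier_eq_convexHull_range, carrier_eq_convexHull_range]
  rcases h with h | ⟨v, hv, h⟩
  · refine subsingleton_convexHull_inter (ht.basis.coord k) (c := 1) (v := t.vertex k) ?_
      (Set.forall_mem_range.2 fun r hr => ?_) (Set.forall_mem_range.2 fun r => ?_)
    · rw [ht.coord_vertex, if_pos rfl]
    · rw [ht.coord_vertex, if_neg (mt (congrArg _) hr.symm)]
      exact one_pos
    · rw [ht.coord_vertex_smul hA]
      exact_mod_cast h r
  · rw [Set.inter_comm]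
    refine subsingleton_convexHull_inter (ht.basis.coord k) (c := 0) (v := (A • t).vertex v) ?_
      (Set.forall_mem_range.2 fun r hr => ?_) (Set.forall_mem_range.2 fun r => ?_)
    · rw [ht.coord_vertex_smul hA]
      exact_mod_cast hv
    · rw [ht.coord_vertex_smul hA]
      exact_mod_cast h r (mt (congrArg _) hr)
    · rw [ht.coord_vertex]
      split_ifs <;> norm_num

end Nondegenerate

end Triangle

/-- The barycentric coordinates of the vertices of the five parts of a dissected triangle, with
respect to this triangle; the parts are taken in the order of `Triangle.dissect`. -/
def childMatrix : Fin 5 → Matrix (Fin 3) (Fin 3) ℚ := ![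
  !![0, 4/5, 1/5; 0, 1, 0; 1, 0, 0],
  !![1/2, 2/5, 1/10; 1, 0, 0; 1/2, 0, 1/2],
  !![1/2, 2/5, 1/10; 0, 4/5, 1/5; 1/2, 0, 1/2],
  !![0, 2/5, 3/5; 1/2, 0, 1/2; 0, 4/5, 1/5],
  !![0, 2/5, 3/5; 1/2, 0, 1/2; 0, 0, 1]]

/-- The inverses of the matrices `childMatrix`: a triangle is recovered from any of its parts. -/
def parentMatrix : Fin 5 → Matrix (Fin 3) (Fin 3) ℚ := ![
  !![0, 0, 1; 0, 1, 0; 5, -4, 0],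
  !![0, 1, 0; 5/2, -1, -1/2; 0, -1, 2],
  !![2, -1, 0; 1/2, 1, -1/2; -2, 1, 2],
  !![-2, 2, 1; -1/2, 0, 3/2; 2, 0, -1],
  !![0, 2, -1; 5/2, 0, -3/2; 0, 0, 1]]

/-- The relative positions of two parts of the same level that have more than one point in common:
the barycentric coordinates of the vertices of one part with respect to the other. Position `0` is
that of the part itself, the positions `1`, `2`, `3` are those of its mirror images in the long leg,
in the short leg and in the hypotenuse, and position `8` is that of its image under the half-turn
about the midpoint of the hypotenuse. -/
def positionMatrix : Fin 12 → Matrix (Fin 3) (Fin 3) ℚ := ![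
  1,
  !![1, 0, 0; 2, -1, 0; 0, 0, 1],
  !![1, 0, 0; 0, 1, 0; 2, 0, -1],
  !![-1, 8/5, 2/5; 0, 1, 0; 0, 0, 1],
  !![1/2, 0, 1/2; 0, 0, 1; 5/2, -2, 1/2],
  !![0, 1, 0; 1/2, 1, -1/2; 2, -1, 0],
  !![1/2, 0, 1/2; 1, 0, 0; 5/2, -2, 1/2],
  !![2, -1, 0; 5/2, -1, -1/2; 0, 1, 0],
  !![-1, 1, 1; 0, 0, 1; 0, 1, 0],
  !![1/2, 0, 1/2; 3/2, -1, 1/2; -1/2, 0, 3/2],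
  !![3/2, 0, -1/2; 5/2, -1, -1/2; 1/2, 0, 1/2],
  !![1/2, 0, 1/2; 3/2, -1, 1/2; 3/2, 0, -1/2]]

/-- The position of part `j` of a triangle relative to part `i` of another triangle, if the first
triangle is in position `m` relative to the second. -/
def childPosition (m : Fin 12) (i j : Fin 5) : Matrix (Fin 3) (Fin 3) ℚ :=
  childMatrix j * positionMatrix m * parentMatrix i

theorem parentMatrix_mul_childMatrix (i : Fin 5) : parentMatrix i * childMatrix i = 1 := by
  revert i
  decide +kernel

theorem childMatrix_mul_parentMatrix (i : Fin 5) : childMatrix i * parentMatrix i = 1 :=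
  mul_eq_one_comm.1 (parentMatrix_mul_childMatrix i)

theorem childMatrix_mulVec_one (i : Fin 5) : childMatrix i *ᵥ 1 = 1 := by
  revert i
  decide +kernel

theorem parentMatrix_mulVec_one (i : Fin 5) : parentMatrix i *ᵥ 1 = 1 := by
  revert i
  decide +kernel

theorem positionMatrix_mulVec_one (m : Fin 12) : positionMatrix m *ᵥ 1 = 1 := by
  revert m
  decide +kernel

theorem childPosition_mulVec_one (m : Fin 12) (i j : Fin 5) : childPosition m i j *ᵥ 1 = 1 := by
  rw [childPosition, ← mulVec_mulVec, ← mulVec_mulVec, parentMatrix_mulVec_one,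
    positionMatrix_mulVec_one, childMatrix_mulVec_one]

theorem childMatrix_nonneg (i : Fin 5) (r k : Fin 3) : 0 ≤ childMatrix i r k := by
  revert r
  revert i k
  decide +kernel

theorem exists_positionMatrix_nonpos {m : Fin 12} (hm : m ≠ 0) :
    ∃ k, ∀ r, positionMatrix m r k ≤ 0 := by
  revert m
  decide +kernel

theorem childPosition_smul (m : Fin 12) (i j : Fin 5) (t : Triangle) :
    childPosition m i j • childMatrix i • t = childMatrix j • positionMatrix m • t := by
  rw [← mul_smul, childPosition, mul_assoc _ (parentMatrix i), parentMatrix_mul_childMatrix,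
    mul_one, mul_smul]

theorem ne_zero_of_ne_positionMatrix_smul {m : Fin 12} {t : Triangle}
    (h : t ≠ positionMatrix m • t) : m ≠ 0 := by
  rintro rfl
  exact h (one_smul _ t).symm

/-- The labels of the parts of an iterated dissection. The first component is the colour of the
part; the second one decides on the free choice in the colouring of its own parts. -/
abbrev Label := ZMod 3 × ZMod 2

/-- The labels of the parts of a triangle with label `a`. Parts `0`, `1`, `2` are mutually adjacent
and get the colours `b`, `b + 1`, `b + 2`; part `4` also gets `b + 2`. Part `3` is adjacent only to
parts `2` and `4`, so that it may get `b` or `b + 1`: this is decided by the second component. -/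
def childLabel (i : Fin 5) (a : Label) : Label :=
  let b := -a.1 - a.2.val
  ![(b, a.2), (b + 1, a.2 + 1), (b + 2, a.2 + 1), (b + a.2.val, a.2), (b + 2, a.2)] i

/-- The possible differences between the label of a part in position `m` relative to another part
and the label of this other part, the second component of which is the second argument. -/
def labelDifferences : Fin 12 → ZMod 2 → Finset Label := ![
  ![{(0, 0)}, {(0, 0)}],
  ![{(1, 0), (2, 0)}, {(1, 0), (2, 0)}],
  ![{(1, 0), (2, 0)}, {(1, 0), (2, 0)}],
  ![{(1, 0), (2, 0)}, {(1, 0), (2, 0)}],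
  ![{(1, 1)}, {(1, 1)}],
  ![{(1, 1)}, {(1, 1)}],
  ![{(2, 1)}, {(2, 1)}],
  ![{(2, 1)}, {(2, 1)}],
  ![{(2, 1)}, {(1, 1)}],
  ![{(2, 1)}, {(1, 1)}],
  ![{(2, 1)}, {(1, 1)}],
  ![{(1, 1)}, {(2, 1)}]]

/-- A part with label `b` may be in position `m` relative to a part with label `a`. -/
def Compatible (m : Fin 12) (a b : Label) : Prop := b - a ∈ labelDifferences m a.2

instance (m : Fin 12) (a b : Label) : Decidable (Compatible m a b) :=
  inferInstanceAs (Decidable (_ ∈ _))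

theorem Compatible.fst_ne {m : Fin 12} {a b : Label} (h : Compatible m a b) (hm : m ≠ 0) :
    a.1 ≠ b.1 := by
  revert m a b
  decide +kernel

theorem childPosition_eq_positionMatrix_or_separates : ∀ (m : Fin 12) (i j : Fin 5),
    (∃ m', childPosition m i j = positionMatrix m' ∧
      ∀ a b, Compatible m a b → Compatible m' (childLabel i a) (childLabel j b)) ∨
    ∃ k, Triangle.Separates k (childPosition m i j) := by
  decide +kernel

theorem subsingleton_inter_child_or_eq_smul {m : Fin 12} {t : Triangle} {a b : Label}
    (ht : t.Nondegenerate) (hab : Compatible m a b) (i j : Fin 5) :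
    ((childMatrix i • t).carrier ∩ (childMatrix j • positionMatrix m • t).carrier).Subsingleton ∨
      ∃ m', childMatrix j • positionMatrix m • t = positionMatrix m' • childMatrix i • t ∧
        Compatible m' (childLabel i a) (childLabel j b) := by
  rw [← childPosition_smul m i j]
  rcases childPosition_eq_positionMatrix_or_separates m i j with ⟨m', h, hlabel⟩ | ⟨k, h⟩
  · exact Or.inr ⟨m', congrArg (· • _) h, hlabel _ _ hab⟩
  · have hchild : (childMatrix i • t).Nondegenerate :=
      ht.smul (childMatrix_mulVec_one i) (parentMatrix_mul_childMatrix i)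
    exact Or.inl (hchild.subsingleton_carrier_inter_smul (childPosition_mulVec_one m i j) h)

namespace Triangle

variable {p s t : Triangle} {n : ℕ}

theorem childMatrix_smul (t : Triangle) : (fun i => childMatrix i • t) =
    ![⟨t.ptD, t.S, t.R⟩, ⟨t.ptN, t.R, t.ptM⟩, ⟨t.ptN, t.ptD, t.ptM⟩, ⟨t.ptE, t.ptM, t.ptD⟩,
      ⟨t.ptE, t.ptM, t.L⟩] := by
  have hD : t.ptD = (4 / 5 : ℚ) • t.S + (1 / 5 : ℚ) • t.L := by
    rw [ptD, AffineMap.lineMap_apply_module]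
    norm_num [Rat.smul_def]
  have hE : t.ptE = (2 / 5 : ℚ) • t.S + (3 / 5 : ℚ) • t.L := by
    rw [ptE, AffineMap.lineMap_apply_module]
    norm_num [Rat.smul_def]
  have hM : t.ptM = (1 / 2 : ℚ) • t.R + (1 / 2 : ℚ) • t.L := by
    rw [ptM, midpoint_eq_smul_add]
    norm_num [Rat.smul_def]
  have hN : t.ptN = (1 / 2 : ℚ) • t.R + (2 / 5 : ℚ) • t.S + (1 / 10 : ℚ) • t.L := by
    rw [ptN, midpoint_eq_smul_add, hD]
    norm_num [Rat.smul_def]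
    ring
  rw [hN, hM, hE, hD]
  funext i
  fin_cases i <;> simp [smul_def, childMatrix]

theorem dissect_eq_range (t : Triangle) : t.dissect = Set.range fun i => childMatrix i • t := by
  rw [childMatrix_smul]
  simp only [Matrix.range_cons, Matrix.range_empty, Set.union_empty, Set.singleton_union, dissect]

/-- The set of parts of level `n` of a triangle: the result of `n` dissections without inflation. -/
def subdivision (p : Triangle) : ℕ → Set Triangle
  | 0 => {p}
  | n + 1 => ⋃ t ∈ p.subdivision n, t.dissect

theorem mem_subdivision_succ_iff :
    t ∈ p.subdivision (n + 1) ↔ ∃ s ∈ p.subdivision n, ∃ i, childMatrix i • s = t := by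
  simp only [subdivision, dissect_eq_range, Set.mem_iUnion₂, Set.mem_range, exists_prop]

theorem map_image_dissect (f : ℂ →ᵃ[ℝ] ℂ) (t : Triangle) :
    map f '' t.dissect = (t.map f).dissect := by
  simp only [dissect_eq_range, ← Set.range_comp, Function.comp_def,
    map_smul f (childMatrix_mulVec_one _)]

theorem map_image_subdivision (f : ℂ →ᵃ[ℝ] ℂ) (p : Triangle) (n : ℕ) :
    map f '' p.subdivision n = (p.map f).subdivision n := by
  induction n with
  | zero => exact Set.image_singleton
  | succ n ih =>
    simp only [subdivision, Set.image_iUnion₂, map_image_dissect, ← ih, Set.biUnion_image]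

end Triangle

/-- `IsLabelledPart p n t a`: the triangle `t` is a part of level `n` of `p`, with label `a` if
`p` itself has label `0`. -/
inductive IsLabelledPart (p : Triangle) : ℕ → Triangle → Label → Prop
  | root : IsLabelledPart p 0 p 0
  | child (i : Fin 5) {n : ℕ} {t : Triangle} {a : Label} :
    IsLabelledPart p n t a → IsLabelledPart p (n + 1) (childMatrix i • t) (childLabel i a)

namespace IsLabelledPart

open Triangle

variable {p s t : Triangle} {n : ℕ} {a b : Label}

theorem exists_of_mem_subdivision (ht : t ∈ p.subdivision n) : ∃ a, IsLabelledPart p n t a := by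
  induction n generalizing t with
  | zero => exact ⟨0, (ht : t = p) ▸ root⟩
  | succ n ih =>
    obtain ⟨s, hs, i, rfl⟩ := mem_subdivision_succ_iff.1 ht
    exact (ih hs).imp' _ fun a ha => ha.child i

theorem nondegenerate (ht : IsLabelledPart p n t a) (hp : p.Nondegenerate) : t.Nondegenerate := by
  induction ht with
  | root => exact hp
  | child i _ ih => exact ih.smul (childMatrix_mulVec_one i) (parentMatrix_mul_childMatrix i)

theorem subsingleton_inter_or_eq_smul (hs : IsLabelledPart p n s a) (ht : IsLabelledPart p n t b)
    (hp : p.Nondegenerate) : (s.carrier ∩ t.carrier).Subsingleton ∨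
      ∃ m, t = positionMatrix m • s ∧ Compatible m a b := by
  induction hs generalizing t b with
  | root =>
    cases ht
    exact Or.inr ⟨0, (one_smul _ _).symm, by decide⟩
  | child i hs ih =>
    obtain _ | @⟨j, _, _, _, ht⟩ := ht
    rcases ih ht with h | ⟨m, rfl, hab⟩
    · exact Or.inl <| h.anti <| Set.inter_subset_inter
        (carrier_smul_subset (childMatrix_mulVec_one i) (childMatrix_nonneg i) _)
        (carrier_smul_subset (childMatrix_mulVec_one j) (childMatrix_nonneg j) _)
    · exact subsingleton_inter_child_or_eq_smul (hs.nondegenerate hp) hab i j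

theorem disjoint_interior (hs : IsLabelledPart p n s a) (ht : IsLabelledPart p n t b)
    (hp : p.Nondegenerate) (hst : s ≠ t) : Disjoint (interior s.carrier) t.carrier := by
  rcases hs.subsingleton_inter_or_eq_smul ht hp with h | ⟨m, rfl, -⟩
  · exact disjoint_interior_of_subsingleton_inter (convex_convexHull ..)
      (ht.nondegenerate hp).interior_carrier_nonempty h
  · obtain ⟨k, hk⟩ := exists_positionMatrix_nonpos (ne_zero_of_ne_positionMatrix_smul hst)
    exact (hs.nondegenerate hp).disjoint_interior_carrier_smul (positionMatrix_mulVec_one m) hk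

theorem fst_ne (hs : IsLabelledPart p n s a) (ht : IsLabelledPart p n t b)
    (hp : p.Nondegenerate) (hst : s ≠ t) (h : (s.carrier ∩ t.carrier).Nontrivial) : a.1 ≠ b.1 := by
  obtain ⟨m, rfl, hab⟩ :=
    (hs.subsingleton_inter_or_eq_smul ht hp).resolve_left (Set.not_subsingleton_iff.2 h)
  exact hab.fst_ne (ne_zero_of_ne_positionMatrix_smul hst)

end IsLabelledPart

namespace Triangle

variable {p s t : Triangle} {n : ℕ}

theorem Nondegenerate.of_mem_subdivision (hp : p.Nondegenerate) (ht : t ∈ p.subdivision n) :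
    t.Nondegenerate :=
  let ⟨_, ha⟩ := IsLabelledPart.exists_of_mem_subdivision ht
  ha.nondegenerate hp

theorem eq_of_mem_interior_of_mem_subdivision (hp : p.Nondegenerate) (hs : s ∈ p.subdivision n)
    (ht : t ∈ p.subdivision n) {x : ℂ} (hxs : x ∈ interior s.carrier) (hxt : x ∈ t.carrier) :
    s = t := by
  by_contra hst
  obtain ⟨a, ha⟩ := IsLabelledPart.exists_of_mem_subdivision hs
  obtain ⟨b, hb⟩ := IsLabelledPart.exists_of_mem_subdivision ht
  exact Set.disjoint_left.1 (ha.disjoint_interior hb hp hst) hxs hxt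

theorem exists_coloring_subdivision (hp : p.Nondegenerate) (n : ℕ) :
    ∃ c : Triangle → ZMod 3, ∀ s ∈ p.subdivision n, ∀ t ∈ p.subdivision n, s ≠ t →
      (s.carrier ∩ t.carrier).Nontrivial → c s ≠ c t := by
  choose! a ha using fun t : Triangle =>
    IsLabelledPart.exists_of_mem_subdivision (p := p) (n := n) (t := t)
  exact ⟨fun t => (a t).1, fun s hs t ht => (ha s hs).fst_ne (ha t ht) hp⟩

end Triangle

theorem exists_subdivision_eq_supertile (n : ℕ) :
    ∃ p : Triangle, p.Nondegenerate ∧ supertile n = p.subdivision n := by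
  let σ : ℂ →ᵃ[ℝ] ℂ := (LinearMap.lsmul ℝ ℂ √5).toAffineMap
  have hσ : Function.Injective σ :=
    smul_right_injective ℂ (Real.sqrt_ne_zero'.2 (by norm_num : (0 : ℝ) < 5))
  induction n with
  | zero => exact ⟨prototile, Triangle.nondegenerate_prototile, rfl⟩
  | succ n ih =>
    obtain ⟨p, hp, h⟩ := ih
    refine ⟨p.map σ, hp.map hσ, ?_⟩
    rw [Triangle.subdivision, ← Triangle.map_image_subdivision, Set.biUnion_image, ← h]
    rfl

/-- Every finite patch of `T` consists of parts of one level of some nondegenerate triangle. This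
is the legality of pinwheel tilings with affine maps instead of similarities; the triangle may have
any shape and size. -/
def IsAffinelyLegal (T : Set Triangle) : Prop :=
  ∀ P ⊆ T, P.Finite → ∃ (p : Triangle) (n : ℕ), p.Nondegenerate ∧ P ⊆ p.subdivision n

theorem IsPinwheelTiling.isAffinelyLegal {T : Set Triangle} (hT : IsPinwheelTiling T) :
    IsAffinelyLegal T := by
  intro P hPT hP
  obtain ⟨n, f, hPf⟩ := hT.legal P hPT hP
  obtain ⟨p, hp, h⟩ := exists_subdivision_eq_supertile n
  let g : ℂ →ᵃ[ℝ] ℂ := f.toRealAffineIsometryEquiv.toAffineEquiv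
  refine ⟨p.map g, n, hp.map f.injective, ?_⟩
  rw [← Triangle.map_image_subdivision, ← h]
  exact hPf

variable {T : Set Triangle}

theorem faceGraph_adj_iff {s t : T} :
    (faceGraph T).Adj s t ↔ s ≠ t ∧ (s.1.carrier ∩ t.1.carrier).Nontrivial := by
  refine and_congr_right fun _ => ⟨fun ⟨x, y, hxy, h⟩ => ?_, fun ⟨x, hx, y, hy, hxy⟩ => ?_⟩
  · exact ⟨x, h (left_mem_segment ℝ x y), y, h (right_mem_segment ℝ x y), hxy⟩
  · have hconvex : Convex ℝ (s.1.carrier ∩ t.1.carrier) :=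
      (convex_convexHull ..).inter (convex_convexHull ..)
    exact ⟨x, y, hxy, hconvex.segment_subset hx hy⟩

theorem IsAffinelyLegal.colorable (hT : IsAffinelyLegal T) : (faceGraph T).Colorable 3 := by
  have hcoloring : Nonempty ((faceGraph T).Coloring (ZMod 3)) := by
    refine SimpleGraph.nonempty_hom_of_forall_finite_subgraph_hom fun G hG => Nonempty.some ?_
    obtain ⟨p, n, hp, hP⟩ := hT _ (Subtype.coe_image_subset T G.verts) (hG.image _)
    obtain ⟨c, hc⟩ := Triangle.exists_coloring_subdivision hp n
    have hmem (v : G.verts) : v.1.1 ∈ p.subdivision n := hP (Set.mem_image_of_mem _ v.2)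
    refine ⟨⟨fun v => c v.1.1, fun {s t} hst => ?_⟩⟩
    obtain ⟨hne, hnontrivial⟩ := faceGraph_adj_iff.1 (G.adj_sub hst)
    exact hc _ (hmem s) _ (hmem t) (Subtype.coe_injective.ne hne) hnontrivial
  simpa only [ZMod.card] using hcoloring.some.colorable

theorem nontrivial_of_iUnion_carrier_eq_univ (hcov : ⋃ t ∈ T, t.carrier = Set.univ) :
    T.Nontrivial := by
  by_contra h
  obtain rfl | ⟨t, rfl⟩ := (Set.not_nontrivial_iff.1 h).eq_empty_or_singleton
  · simp [Set.empty_ne_univ] at hcov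
  · rw [Set.biUnion_singleton] at hcov
    exact noncompact_univ ℂ (hcov ▸ t.isCompact_carrier)

-- The triangles of which a given tile `t₀` may be a part are the `parentMatrix i • t₀`. The finite
-- patch is chosen so that it contains a tile `τ i j` over an interior point of each of their parts;
-- for the `i` that legality provides, these five tiles must be the parts themselves.
theorem IsAffinelyLegal.exists_forall_child_mem (hT : IsAffinelyLegal T)
    (hcov : ⋃ t ∈ T, t.carrier = Set.univ) :
    ∃ s : Triangle, s.Nondegenerate ∧ ∀ i, childMatrix i • s ∈ T := by
  obtain ⟨t₀, ht₀, t₁, ht₁, hne⟩ := nontrivial_of_iUnion_carrier_eq_univ hcov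
  have hnondeg : t₀.Nondegenerate := by
    obtain ⟨p, n, hp, hP⟩ := hT {t₀} (Set.singleton_subset_iff.2 ht₀) (Set.finite_singleton t₀)
    exact hp.of_mem_subdivision (hP rfl)
  have hinterior (i j : Fin 5) :
      (interior (childMatrix j • parentMatrix i • t₀).carrier).Nonempty :=
    ((hnondeg.smul (parentMatrix_mulVec_one i) (childMatrix_mul_parentMatrix i)).smul
      (childMatrix_mulVec_one j) (parentMatrix_mul_childMatrix j)).interior_carrier_nonempty
  choose x hx using hinterior
  have hcover (i j : Fin 5) : ∃ t ∈ T, x i j ∈ t.carrier := by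
    simpa only [Set.mem_iUnion₂, exists_prop] using hcov.ge (Set.mem_univ (x i j))
  choose τ hτ hxτ using hcover
  obtain ⟨p, n, hp, hP⟩ := hT ({t₀, t₁} ∪ Set.range (Function.uncurry τ))
    (Set.union_subset (Set.pair_subset ht₀ ht₁) (Set.range_subset_iff.2 fun ij => hτ ij.1 ij.2))
    ((Set.toFinite _).union (Set.finite_range _))
  have hτp (i j : Fin 5) : τ i j ∈ p.subdivision n := hP (Or.inr ⟨(i, j), rfl⟩)
  have h₀ : t₀ ∈ p.subdivision n := hP (Or.inl (Or.inl rfl))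
  have h₁ : t₁ ∈ p.subdivision n := hP (Or.inl (Or.inr rfl))
  cases n with
  | zero => exact absurd ((h₀ : t₀ = p).trans (h₁ : t₁ = p).symm) hne
  | succ n =>
    obtain ⟨s, hs, i, rfl⟩ := Triangle.mem_subdivision_succ_iff.1 h₀
    refine ⟨s, hp.of_mem_subdivision hs, fun j => ?_⟩
    have hj : childMatrix j • s ∈ p.subdivision (n + 1) :=
      Triangle.mem_subdivision_succ_iff.2 ⟨s, hs, j, rfl⟩
    have hxj : x i j ∈ interior (childMatrix j • s).carrier := by
      simpa only [← mul_smul (parentMatrix i), parentMatrix_mul_childMatrix, one_smul] using hx i j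
    rw [Triangle.eq_of_mem_interior_of_mem_subdivision hp hj (hτp i j) hxj (hxτ i j)]
    exact hτ i j

open Triangle in
theorem three_le_chromaticNumber_of_forall_child_mem {s : Triangle} (hs : s.Nondegenerate)
    (hsT : ∀ i, childMatrix i • s ∈ T) : 3 ≤ (faceGraph T).chromaticNumber := by
  classical
  have hchild (i : Fin 5) : childMatrix i • s ∈ T ∧ (childMatrix i • s).Nondegenerate :=
    ⟨hsT i, hs.smul (childMatrix_mulVec_one i) (parentMatrix_mul_childMatrix i)⟩
  have hDSR := hchild 0
  have hNRM := hchild 1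
  have hNDM := hchild 2
  rw [congrFun s.childMatrix_smul] at hDSR hNRM hNDM
  have hDR : s.ptD ≠ s.R := hDSR.2.vertex_injective.ne (by decide : (0 : Fin 3) ≠ 2)
  have hNR : s.ptN ≠ s.R := hNRM.2.vertex_injective.ne (by decide : (0 : Fin 3) ≠ 1)
  have hND : s.ptN ≠ s.ptD := hNDM.2.vertex_injective.ne (by decide : (0 : Fin 3) ≠ 1)
  have hNM : s.ptN ≠ s.ptM := hNDM.2.vertex_injective.ne (by decide : (0 : Fin 3) ≠ 2)
  have hN : s.ptN ∈ carrier ⟨s.ptD, s.S, s.R⟩ :=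
    (convex_convexHull ..).midpoint_mem (vertex_mem_carrier _ 2) (vertex_mem_carrier _ 0)
  have hclique : (faceGraph T).IsNClique 3 {⟨_, hDSR.1⟩, ⟨_, hNRM.1⟩, ⟨_, hNDM.1⟩} := by
    simp only [SimpleGraph.is3Clique_triple_iff, faceGraph_adj_iff]
    refine ⟨⟨by simp [hND.symm], s.ptN, ⟨hN, ?_⟩, s.R, ⟨?_, ?_⟩, hNR⟩,
      ⟨by simp [hND.symm], s.ptN, ⟨hN, ?_⟩, s.ptD, ⟨?_, ?_⟩, hND⟩,
      ⟨by simp [hDR.symm], s.ptN, ⟨?_, ?_⟩, s.ptM, ⟨?_, ?_⟩, hNM⟩⟩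
    exacts [vertex_mem_carrier _ 0, vertex_mem_carrier _ 2, vertex_mem_carrier _ 1,
      vertex_mem_carrier _ 0, vertex_mem_carrier _ 0, vertex_mem_carrier _ 1,
      vertex_mem_carrier _ 0, vertex_mem_carrier _ 0, vertex_mem_carrier _ 2,
      vertex_mem_carrier _ 2]
  exact_mod_cast hclique.card_eq ▸ hclique.isClique.card_le_chromaticNumber

end Pinwheel

theorem theorem6p9_general (T : Set Pinwheel.Triangle) (hcov : ⋃ t ∈ T, t.carrier = Set.univ)
    (hT : Pinwheel.IsAffinelyLegal T) : (Pinwheel.faceGraph T).chromaticNumber = 3 := by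
  obtain ⟨s, hs, hsT⟩ := hT.exists_forall_child_mem hcov
  exact le_antisymm hT.colorable.chromaticNumber_le
    (Pinwheel.three_le_chromaticNumber_of_forall_child_mem hs hsT)

theorem theorem6p9 (T : Set Pinwheel.Triangle) (hT : Pinwheel.IsPinwheelTiling T) :
    (Pinwheel.faceGraph T).chromaticNumber = 3 :=
  theorem6p9_general T hT.covers hT.isAffinelyLegal
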